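/- **Conventions.** A (discrete-time LTI) system with $n_x$ states, $n_u$ inputs and $n_y$ outputs is a tuple $S=(A,B,C,D)$ of real matrices of sizes $n_x\times n_x$, $n_x\times n_u$, $n_y\times n_x$, $n_y\times n_u$, with $x_{k+1}=Ax_k+Bu_k$, $y_k=Cx_k+Du_k$. It is SISO if $n_u=n_y=1$. It is a minimal realization if no system with fewer states produces, from zero initial state, the same output sequence for every input sequence. The graph $G(S)$ has as vertices the state variables $x_i$, the inputs $u_j$ and the outputs $y_i$, with edges $(x_j,x_i)$ iff $A_{ij}\ne0$, $(u_j,x_i)$ iff $B_{ij}\ne0$, $(x_j,y_i)$ iff $C_{ij}\ne0$, $(u_j,y_i)$ iff $D_{ij}\ne0$, and no others. The condensed graph $CG(S)$ has as vertices the inputs, the outputs, and the strong components of $G(S)$ that consist of state variables (one-element components included). For components $c,c'$ (possibly equal), an input $u$ and an output $y$, it has the edge $(u,c)$ iff $G(S)$ has an edge from $u$ to a vertex of $c$; $(c,c')$ iff $G(S)$ has an edge from a vertex of $c$ to a vertex of $c'$ (so $c$ has a loop iff $G(S)$ has an edge inside $c$, including a loop); $(c,y)$ iff $G(S)$ has an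 edge from a vertex of $c$ to $y$; $(u,y)$ iff $(u,y)$ is an edge of $G(S)$; and no others. Two systems are CG-isomorphic if there is a directed-graph isomorphism between their condensed graphs that maps inputs to inputs, outputs to outputs and state components to state components. For a real $n\times n$ matrix $A$, let $D_k$ be the monic greatest common divisor of the minors of order $k$ of $\lambda I-A$ ($D_0=1$). The invariant polynomials of $A$ are $i_j=D_{n-j+1}/D_{n-j}$, $1\le j\le n$. The elementary divisors of $A$ are the powers $\phi^m$, $m>0$, of distinct monic real-irreducible polynomials $\phi$ that occur in the factorizations of $i_1,\dots,i_n$, listed with repetition. The companion matrix of $s^n+a_1s^{n-1}+\cdots+a_n$ is the $n\times n$ matrix with ones on the subdiagonal, last column $(-a_n,-a_{n-1},\dots,-a_1)^T$ and zeros elsewhere. $A$ is in second natural normal form if $A$ is block-diagonal with diagonal blocks $L_1,\dots,L_k$, where $L_i$ is the companion matrix of $e_i$ and $e_1,\dots,e_k$ are the elementary divisors of $A$ in some order. **Theorem.** Let $S_1=(A_1,B_1,C_1,D_1)$ and $S_2=(A_2,B_2,C_2,D_2)$ be two minimal SISO realizations where $A_1$ and $A_2$ are in second natural normal form and $0$ is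 not an eigenvalue of either $A_1$ or $A_2$. Then $S_1$ and $S_2$ are CG-isomorphic if and only if both of the following hold: 1. the number of distinct irreducible real polynomials (up to constant factors) that divide $\det(\lambda I-A_1)$ equals the number of those that divide $\det(\lambda I-A_2)$; 2. either $D_1=D_2=0$, or $D_1\ne0$ and $D_2\ne0$. -/

import Mathlib

/-- The associated (directed) graph of a square matrix `M`: there is an edge from `v` to `w`
exactly when the entry of `M` in row `w` and column `v` is nonzero. -/
def Matrix.associatedGraph {V : Type*} (M : Matrix V V ℝ) : Digraph V where
  Adj v w := M w v ≠ 0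

/-- The strong components of a directed graph: the equivalence classes of the relation
"there are directed paths (possibly of length zero) from `a` to `b` and from `b` to `a`". -/
def Digraph.strongComponents {V : Type*} (G : Digraph V) : Set (Set V) :=
  {c | ∃ a, c = {b | Relation.ReflTransGen G.Adj a b ∧ Relation.ReflTransGen G.Adj b a}}

/-- A discrete-time LTI state-space system with `nx` state variables, `nu` inputs and `ny` outputs:
`x (k+1) = A x k + B u k`, `y k = C x k + D u k`. -/
structure LTISystem (nx nu ny : ℕ) where
  A : Matrix (Fin nx) (Fin nx) ℝ
  B : Matrix (Fin nx) (Fin nu) ℝ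
  C : Matrix (Fin ny) (Fin nx) ℝ
  D : Matrix (Fin ny) (Fin nu) ℝ

namespace LTISystem

/-- The state sequence for the input sequence `u`, with zero initial state. -/
def stateSeq {nx nu ny : ℕ} (S : LTISystem nx nu ny) (u : ℕ → Fin nu → ℝ) : ℕ → Fin nx → ℝ
  | 0 => 0
  | k + 1 => S.A.mulVec (S.stateSeq u k) + S.B.mulVec (u k)

/-- The output sequence for the input sequence `u`, with zero initial state. -/
def outputSeq {nx nu ny : ℕ} (S : LTISystem nx nu ny) (u : ℕ → Fin nu → ℝ) (k : ℕ) : Fin ny → ℝ :=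
  S.C.mulVec (S.stateSeq u k) + S.D.mulVec (u k)

/-- Two systems are equivalent if, from zero initial conditions, they produce identical outputs for
every input sequence. -/
def Equivalent {nx nx' nu ny : ℕ} (S : LTISystem nx nu ny) (S' : LTISystem nx' nu ny) : Prop :=
  ∀ (u : ℕ → Fin nu → ℝ) (k : ℕ), S.outputSeq u k = S'.outputSeq u k

/-- A realization is minimal if no realization of the same input/output behaviour has fewer state
variables. -/
def IsMinimal {nx nu ny : ℕ} (S : LTISystem nx nu ny) : Prop :=
  ∀ (nx' : ℕ) (S' : LTISystem nx' nu ny), S.Equivalent S' → nx ≤ nx'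

/-- The vertices of the graph of a system: state variables, inputs and outputs, in this order. -/
abbrev Vertex (nx nu ny : ℕ) : Type := (Fin nx ⊕ Fin nu) ⊕ Fin ny

/-- The block matrix with block rows `[A B 0]`, `[0 0 0]`, `[C D 0]`. -/
def systemMatrix {nx nu ny : ℕ} (S : LTISystem nx nu ny) :
    Matrix (Vertex nx nu ny) (Vertex nx nu ny) ℝ :=
  Matrix.fromBlocks (Matrix.fromBlocks S.A S.B 0 0) 0 (Matrix.fromCols S.C S.D) 0

/-- The associated graph of a system. -/
def graph {nx nu ny : ℕ} (S : LTISystem nx nu ny) : Digraph (Vertex nx nu ny) :=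
  S.systemMatrix.associatedGraph

/-- The state variable components: the strong components consisting of state variable vertices. -/
def stateComponents {nx nu ny : ℕ} (S : LTISystem nx nu ny) : Set (Set (Vertex nx nu ny)) :=
  {c | c ∈ S.graph.strongComponents ∧ ∀ v ∈ c, ∃ i : Fin nx, v = Sum.inl (Sum.inl i)}

/-- The vertices of the condensed graph: the input vertices, the state variable components and the
output vertices. -/
inductive CondensedVertex {nx nu ny : ℕ} (S : LTISystem nx nu ny) : Type
  | input (i : Fin nu) : CondensedVertex S
  | component (c : S.stateComponents) : CondensedVertex S
  | output (i : Fin ny) : CondensedVertex S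

/-- The edges of the condensed graph. -/
def CondensedAdj {nx nu ny : ℕ} (S : LTISystem nx nu ny) :
    S.CondensedVertex → S.CondensedVertex → Prop
  | .input i, .component c => ∃ v ∈ c.1, S.graph.Adj (Sum.inl (Sum.inr i)) v
  | .component c, .component c' => ∃ v ∈ c.1, ∃ w ∈ c'.1, S.graph.Adj v w
  | .component c, .output j => ∃ v ∈ c.1, S.graph.Adj v (Sum.inr j)
  | .input i, .output j => S.graph.Adj (Sum.inl (Sum.inr i)) (Sum.inr j)
  | _, _ => False

/-- The condensed graph of a system. -/
def condensedGraph {nx nu ny : ℕ} (S : LTISystem nx nu ny) : Digraph S.CondensedVertex where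
  Adj := S.CondensedAdj

/-- Vertices of two condensed graphs are of the same type if both are inputs, both are outputs, or
both are state variable components. -/
def SameType {nx nu ny nx' nu' ny' : ℕ} {S : LTISystem nx nu ny} {S' : LTISystem nx' nu' ny'} :
    S.CondensedVertex → S'.CondensedVertex → Prop
  | .input _, .input _ => True
  | .component _, .component _ => True
  | .output _, .output _ => True
  | _, _ => False

/-- A CG-isomorphism: a type-restricted isomorphism between the condensed graphs. -/
structure IsCGIsomorphism {nx nu ny nx' nu' ny' : ℕ} (S : LTISystem nx nu ny)
    (S' : LTISystem nx' nu' ny') (φ : S.CondensedVertex → S'.CondensedVertex) : Prop where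
  typeRestricted : ∀ v, SameType v (φ v)
  bijective : Function.Bijective φ
  adj_iff : ∀ v w, S.condensedGraph.Adj v w ↔ S'.condensedGraph.Adj (φ v) (φ w)

/-- Two systems are CG-isomorphic if a CG-isomorphism between them exists. -/
def CGIsomorphic {nx nu ny nx' nu' ny' : ℕ} (S : LTISystem nx nu ny)
    (S' : LTISystem nx' nu' ny') : Prop :=
  ∃ φ : S.CondensedVertex → S'.CondensedVertex, IsCGIsomorphism S S' φ

end LTISystem

/-- The companion matrix of a (monic) polynomial `l` of degree `n`: ones on the subdiagonal, last
column `-l₀, -l₁, …, -lₙ₋₁` (coefficients of `1, s, …, sⁿ⁻¹`), all other entries zero. -/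
def companionMatrix (l : Polynomial ℝ) : Matrix (Fin l.natDegree) (Fin l.natDegree) ℝ :=
  Matrix.of fun i j =>
    if (j : ℕ) + 1 = l.natDegree then -l.coeff i
    else if (i : ℕ) = (j : ℕ) + 1 then 1
    else 0

noncomputable section

/-- The determinantal divisor `D_k`: the (monic) greatest common divisor of the minors of order `k`
of the characteristic matrix `λI - A`. -/
def Matrix.determinantalDivisor {n : ℕ} (A : Matrix (Fin n) (Fin n) ℝ) (k : ℕ) : Polynomial ℝ :=
  (Finset.univ : Finset ((Fin k ↪o Fin n) × (Fin k ↪o Fin n))).gcd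
    fun rc => ((Matrix.charmatrix A).submatrix rc.1 rc.2).det

/-- The invariant polynomials of `A`, `i_{j+1} = D_{n-j} / D_{n-j-1}` for `0 ≤ j < n`. -/
def Matrix.invariantPolynomial {n : ℕ} (A : Matrix (Fin n) (Fin n) ℝ) (j : Fin n) : Polynomial ℝ :=
  A.determinantalDivisor (n - j) / A.determinantalDivisor (n - j - 1)

open Classical in
/-- The elementary divisors of `A`, with multiplicity: the powers `φ ^ m`, `m > 0`, of distinct
monic irreducible polynomials `φ` in the factorizations of the invariant polynomials of `A`. -/
def Matrix.elementaryDivisors {n : ℕ} (A : Matrix (Fin n) (Fin n) ℝ) : Multiset (Polynomial ℝ) :=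
  ∑ j : Fin n,
    (UniqueFactorizationMonoid.normalizedFactors (A.invariantPolynomial j)).toFinset.val.map
      fun φ => φ ^ (UniqueFactorizationMonoid.normalizedFactors (A.invariantPolynomial j)).count φ

/-- `A` is in second natural normal form: for some ordering `e₁, …, eₖ` of the elementary divisors
of `A`, the matrix `A` is block-diagonal with the companion matrices of `e₁, …, eₖ` as its
consecutive diagonal blocks. -/
def Matrix.IsSecondNaturalNormalForm {n : ℕ} (A : Matrix (Fin n) (Fin n) ℝ) : Prop :=
  ∃ (k : ℕ) (e : Fin k → Polynomial ℝ) (h : ∑ i, (e i).natDegree = n),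
    (Finset.univ : Finset (Fin k)).val.map e = A.elementaryDivisors ∧
    A = Matrix.reindex (finSigmaFinEquiv.trans (finCongr h)) (finSigmaFinEquiv.trans (finCongr h))
      (Matrix.blockDiagonal' fun i => companionMatrix (e i))

/-- The number of distinct irreducible real polynomials (up to constant factors, so counted by their
monic representatives) that divide `det (λI - A)`. -/
def Matrix.numIrreducibleFactors {n : ℕ} (A : Matrix (Fin n) (Fin n) ℝ) : ℕ :=
  {p : Polynomial ℝ | p.Monic ∧ Irreducible p ∧ p ∣ A.charpoly}.ncard

end

/-! Minimality and a nonzero constant term in every block leave almost no freedom in the condensed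
graph. If the monic `p` satisfies C A^m p(A) B = 0 for all m, the Markov parameters obey the
recurrence of `p`, so a realization with deg `p` states exists and minimality gives n ≤ deg `p`
(`IsMinimal.le_natDegree`). Taking for `p` the product of all elementary divisors but one shows that
every block meets both B and C, and that its divisor does not divide the product of the others
(`IsMinimal.block_nondegenerate`). Hence the primes of the blocks are distinct, and the number of
blocks is the number of irreducible factors of the characteristic polynomial.

As 0 is not an eigenvalue, each companion block has a strongly connected graph. The state components
are therefore exactly the blocks: each has a loop, an edge from the input and an edge to the output,
and distinct ones are not joined. Only the number of blocks and the presence of the edge from input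
to output remain to distinguish two systems. -/

open Polynomial

/-! ### Order reduction through the observer form. -/

namespace LTISystem

/-- The realization in observer form whose state matrix is the transposed companion matrix of `p`
and which has the same first Markov parameters as `S`. -/
noncomputable def observerRealization {n nu : ℕ} (S : LTISystem n nu 1) (p : ℝ[X]) :
    LTISystem p.natDegree nu 1 where
  A := (companionMatrix p).transpose
  B := Matrix.of fun i j => (S.C * S.A ^ (i : ℕ) * S.B) 0 j
  C := Matrix.of fun _ j => if (j : ℕ) = 0 then 1 else 0
  D := S.D

/-- All shifts `X ^ m` are carried along because one time step turns A into one more factor `X`. -/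
theorem mul_aeval_mulVec_stateSeq_eq_zero {n nu ny : ℕ} (S : LTISystem n nu ny) (p : ℝ[X])
    (h : ∀ m : ℕ, S.C * aeval S.A (X ^ m * p) * S.B = 0) (u : ℕ → Fin nu → ℝ) (k m : ℕ) :
    (S.C * aeval S.A (X ^ m * p)).mulVec (S.stateSeq u k) = 0 := by
  induction k generalizing m with
  | zero => simp [stateSeq]
  | succ k ih =>
    have hcomm : S.C * aeval S.A (X ^ m * p) * S.A = S.C * aeval S.A (X ^ (m + 1) * p) := by
      rw [Matrix.mul_assoc]
      congr 1
      rw [show (X : ℝ[X]) ^ (m + 1) * p = X ^ m * p * X by ring, map_mul _ _ X, aeval_X]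
    rw [stateSeq, Matrix.mulVec_add, Matrix.mulVec_mulVec, Matrix.mulVec_mulVec, h m, hcomm, ih]
    simp

/-- Coordinate i of the observer state is the output that the state of `S` would give i steps later
under zero input and without feedthrough. -/
theorem stateSeq_observerRealization {n nu : ℕ} (S : LTISystem n nu 1) {p : ℝ[X]} (hp : p.Monic)
    (h : ∀ m : ℕ, S.C * aeval S.A (X ^ m * p) * S.B = 0) (u : ℕ → Fin nu → ℝ) (k : ℕ)
    (i : Fin p.natDegree) :
    (S.observerRealization p).stateSeq u k i
      = (S.C * S.A ^ (i : ℕ)).mulVec (S.stateSeq u k) 0 := by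
  induction k generalizing i with
  | zero => simp [stateSeq]
  | succ k ih =>
    rw [stateSeq, stateSeq, Matrix.mulVec_add, Matrix.mulVec_mulVec, Matrix.mulVec_mulVec,
      Pi.add_apply, Pi.add_apply]
    congr 1
    have hs : S.C * S.A ^ (i : ℕ) * S.A = S.C * S.A ^ ((i : ℕ) + 1) := by
      rw [Matrix.mul_assoc, pow_succ]
    rw [hs]
    simp only [observerRealization, Matrix.mulVec, dotProduct, Matrix.transpose_apply] at ih ⊢
    by_cases hi : (i : ℕ) + 1 = p.natDegree
    -- The last coordinate has no successor: since `p` is monic, C p(A) x = 0 expresses C A^(deg p)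
    -- x through the lower powers.
    · have hz := congrFun (S.mul_aeval_mulVec_stateSeq_eq_zero p h u k 0) 0
      rw [pow_zero, one_mul, aeval_eq_sum_range, Finset.sum_range_succ, hp.coeff_natDegree,
        one_smul, Matrix.mul_add, Matrix.add_mulVec, Pi.add_apply, Matrix.mul_sum,
        Matrix.sum_mulVec, Finset.sum_apply, Finset.sum_range] at hz
      rw [hi]
      refine Eq.trans ?_ (eq_neg_of_add_eq_zero_right hz).symm
      rw [← Finset.sum_neg_distrib]
      refine Finset.sum_congr rfl fun j _ => ?_
      rw [ih j]
      simp [companionMatrix, hi, Matrix.mulVec, dotProduct, Finset.mul_sum, mul_assoc]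
    · have hlt : (i : ℕ) + 1 < p.natDegree := by omega
      rw [Finset.sum_eq_single ⟨i + 1, hlt⟩]
      · rw [ih]
        simp [companionMatrix, hi]
      · intro j _ hj
        have : (j : ℕ) ≠ i + 1 := fun hh => hj (Fin.ext hh)
        simp [companionMatrix, hi, this]
      · simp

theorem equivalent_observerRealization {n nu : ℕ} (S : LTISystem n nu 1) {p : ℝ[X]} (hp : p.Monic)
    (h : ∀ m : ℕ, S.C * aeval S.A (X ^ m * p) * S.B = 0) :
    S.Equivalent (S.observerRealization p) := by
  intro u k
  funext o
  obtain rfl : o = 0 := Subsingleton.elim _ _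
  rw [outputSeq, outputSeq, Pi.add_apply, Pi.add_apply]
  congr 1
  have key : (S.observerRealization p).C.mulVec ((S.observerRealization p).stateSeq u k) 0
      = ∑ i : Fin p.natDegree,
        if (i : ℕ) = 0 then (S.C * S.A ^ (i : ℕ)).mulVec (S.stateSeq u k) 0 else 0 := by
    simp only [Matrix.mulVec, dotProduct]
    refine Finset.sum_congr rfl fun i _ => ?_
    rw [S.stateSeq_observerRealization hp h]
    simp [observerRealization, Matrix.mulVec, dotProduct]
  rw [key]
  by_cases hd : p.natDegree = 0
  -- Without observer states there is no coordinate 0 to read; here the hypothesis itself says that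
  -- C x vanishes.
  · have hp1 : p = 1 := hp.natDegree_eq_zero.1 hd
    have hz := congrFun (S.mul_aeval_mulVec_stateSeq_eq_zero p h u k 0) 0
    have : IsEmpty (Fin p.natDegree) := by rw [hd]; infer_instance
    rw [Finset.univ_eq_empty, Finset.sum_empty]
    simpa [hp1] using hz
  · rw [Finset.sum_eq_single ⟨0, Nat.pos_of_ne_zero hd⟩]
    · simp
    · intro j _ hj
      rw [if_neg fun hh => hj (Fin.ext hh)]
    · simp

theorem IsMinimal.le_natDegree {n nu : ℕ} {S : LTISystem n nu 1} (hS : S.IsMinimal) {p : ℝ[X]}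
    (hp : p.Monic) (h : ∀ m : ℕ, S.C * aeval S.A (X ^ m * p) * S.B = 0) : n ≤ p.natDegree :=
  hS _ _ (S.equivalent_observerRealization hp h)

end LTISystem

/-! ### Companion and block-diagonal matrices. -/

/-- The companion matrix is multiplication by the root in the power basis of `AdjoinRoot l`. -/
theorem charpoly_companionMatrix {l : ℝ[X]} (hl : l.Monic) : (companionMatrix l).charpoly = l := by
  have h := PowerBasis.leftMulMatrix (AdjoinRoot.powerBasis hl.ne_zero)
  have h2 := charpoly_leftMulMatrix (AdjoinRoot.powerBasis hl.ne_zero)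
  rw [AdjoinRoot.minpoly_powerBasis_gen_of_monic hl] at h2
  rw [PowerBasis.minpolyGen_eq, AdjoinRoot.minpoly_powerBasis_gen_of_monic hl] at h
  rw [h] at h2
  exact h2

theorem aeval_companionMatrix_eq_zero {l q : ℝ[X]} (hl : l.Monic) (h : l ∣ q) :
    aeval (companionMatrix l) q = 0 := by
  obtain ⟨r, rfl⟩ := h
  have := Matrix.aeval_self_charpoly (companionMatrix l)
  rw [charpoly_companionMatrix hl] at this
  rw [map_mul, this, zero_mul]

theorem Matrix.charpoly_blockDiagonal' {k : ℕ} {m : Fin k → ℕ}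
    (M : ∀ i, Matrix (Fin (m i)) (Fin (m i)) ℝ) :
    (Matrix.blockDiagonal' M).charpoly = ∏ i, (M i).charpoly := by
  rw [Matrix.charpoly, Matrix.BlockTriangular.det_fintype (b := Sigma.fst)
    (Matrix.blockTriangular_blockDiagonal' M).charmatrix]
  refine Finset.prod_congr rfl fun i _ => ?_
  rw [Matrix.charpoly, ← Matrix.det_reindex_self (Equiv.sigmaSubtype i)]
  congr 1
  ext a b : 2
  by_cases hab : a = b <;>
    simp [Matrix.toSquareBlock_def, Matrix.charmatrix_apply, Matrix.diagonal_apply, hab,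
      Equiv.sigmaSubtype]

theorem Matrix.aeval_blockDiagonal' {k : ℕ} {m : Fin k → ℕ}
    (M : ∀ i, Matrix (Fin (m i)) (Fin (m i)) ℝ) (q : ℝ[X]) :
    aeval (Matrix.blockDiagonal' M) q = Matrix.blockDiagonal' fun i => aeval (M i) q := by
  induction q using Polynomial.induction_on' with
  | add p q hp hq =>
    simp only [map_add, hp, hq]
    rw [← Matrix.blockDiagonal'_add]; rfl
  | monomial j a =>
    simp only [aeval_monomial, ← Matrix.blockDiagonal'_pow, Algebra.algebraMap_eq_smul_one,
      smul_mul_assoc, one_mul, ← Matrix.blockDiagonal'_smul]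
    rfl

theorem Matrix.aeval_reindex {m n : Type*} [Fintype m] [Fintype n] [DecidableEq m] [DecidableEq n]
    (σ : m ≃ n) (M : Matrix m m ℝ) (q : ℝ[X]) :
    aeval (Matrix.reindex σ σ M) q = Matrix.reindex σ σ (aeval M q) := by
  simpa using Polynomial.aeval_algHom_apply (Matrix.reindexAlgEquiv ℝ ℝ σ).toAlgHom M q

/-! ### Prime-power blocks of the normal form. -/

theorem Matrix.exists_eq_pow_of_mem_elementaryDivisors {n : ℕ} {A : Matrix (Fin n) (Fin n) ℝ}
    {e : ℝ[X]} (he : e ∈ A.elementaryDivisors) :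
    ∃ (φ : ℝ[X]) (m : ℕ), φ.Monic ∧ Irreducible φ ∧ 0 < m ∧ e = φ ^ m := by
  classical
  simp only [Matrix.elementaryDivisors, Multiset.mem_sum, Multiset.mem_map, Finset.mem_val,
    Multiset.mem_toFinset] at he
  obtain ⟨j, -, φ, hφ, rfl⟩ := he
  have hirr := UniqueFactorizationMonoid.irreducible_of_normalized_factor φ hφ
  refine ⟨φ, _, ?_, hirr, Multiset.count_pos.2 hφ, rfl⟩
  have := UniqueFactorizationMonoid.normalize_normalized_factor φ hφ
  rw [← this]
  exact monic_normalize hirr.ne_zero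

/-- A presentation of `A` as a block-diagonal matrix whose blocks are companion matrices of powers
of monic irreducible polynomials. -/
structure PrimaryBlocks {n : ℕ} (A : Matrix (Fin n) (Fin n) ℝ) where
  k : ℕ
  φ : Fin k → ℝ[X]
  m : Fin k → ℕ
  monic : ∀ i, (φ i).Monic
  irreducible : ∀ i, Irreducible (φ i)
  pos : ∀ i, 0 < m i
  σ : (Σ i, Fin (φ i ^ m i).natDegree) ≃ Fin n
  eq_reindex : A = Matrix.reindex σ σ (Matrix.blockDiagonal' fun i => companionMatrix (φ i ^ m i))

/-- All that is kept of the elementary divisors is that they are prime powers; distinctness of the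
primes will come from minimality. -/
theorem Matrix.IsSecondNaturalNormalForm.nonempty_primaryBlocks {n : ℕ}
    {A : Matrix (Fin n) (Fin n) ℝ} (hA : A.IsSecondNaturalNormalForm) :
    Nonempty (PrimaryBlocks A) := by
  obtain ⟨k, e, h, he, hA⟩ := hA
  have hmem : ∀ i, e i ∈ A.elementaryDivisors := fun i => by
    rw [← he]
    exact Multiset.mem_map_of_mem e (Finset.mem_univ_val i)
  choose φ m hφ hirr hm hem using fun i => exists_eq_pow_of_mem_elementaryDivisors (hmem i)
  obtain rfl : e = fun i => φ i ^ m i := funext hem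
  exact ⟨⟨k, φ, m, hφ, hirr, hm, _, hA⟩⟩

namespace PrimaryBlocks

variable {n : ℕ} {A : Matrix (Fin n) (Fin n) ℝ} (P : PrimaryBlocks A)

/-- The elementary divisor belonging to a block. -/
noncomputable abbrev e (i : Fin P.k) : ℝ[X] := P.φ i ^ P.m i

theorem monic_e (i : Fin P.k) : (P.e i).Monic := (P.monic i).pow _

theorem natDegree_e_pos (i : Fin P.k) : 0 < (P.e i).natDegree := by
  rw [(P.monic i).natDegree_pow]
  exact Nat.mul_pos (P.pos i) (P.irreducible i).natDegree_pos

theorem apply_eq (x y : Σ i, Fin (P.e i).natDegree) :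
    A (P.σ x) (P.σ y) = Matrix.blockDiagonal' (fun i => companionMatrix (P.e i)) x y := by
  refine (congrFun (congrFun P.eq_reindex (P.σ x)) (P.σ y)).trans ?_
  simp

theorem charpoly_eq : A.charpoly = ∏ i, P.e i := by
  conv_lhs => rw [P.eq_reindex]
  rw [Matrix.charpoly_reindex, Matrix.charpoly_blockDiagonal']
  exact Finset.prod_congr rfl fun i _ => charpoly_companionMatrix (P.monic_e i)

theorem natDegree_prod : ∑ i, (P.e i).natDegree = n := by
  rw [← natDegree_prod_of_monic _ _ fun i _ => P.monic_e i, ← P.charpoly_eq,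
    Matrix.charpoly_natDegree_eq_dim, Fintype.card_fin]

theorem coeff_zero_ne (h0 : ¬ Module.End.HasEigenvalue (Matrix.toLin' A) 0) (i : Fin P.k) :
    (P.e i).coeff 0 ≠ 0 := by
  intro hi
  apply h0
  rw [Module.End.hasEigenvalue_iff_isRoot_charpoly, Matrix.charpoly_toLin', P.charpoly_eq,
    IsRoot.def, eval_prod]
  exact Finset.prod_eq_zero (Finset.mem_univ i) (by rw [← coeff_zero_eq_eval_zero, hi])

/-- C q(A) B is a sum of contributions of single blocks. A contribution vanishes if its part of C or
of B does, or, by Cayley–Hamilton, if the divisor of the block divides `q`. -/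
theorem mul_aeval_mul_eq_zero {nu ny : ℕ} (B : Matrix (Fin n) (Fin nu) ℝ)
    (C : Matrix (Fin ny) (Fin n) ℝ) (q : ℝ[X])
    (h : ∀ l, (∀ o a, C o (P.σ ⟨l, a⟩) = 0) ∨ (∀ a j, B (P.σ ⟨l, a⟩) j = 0) ∨ P.e l ∣ q) :
    C * aeval A q * B = 0 := by
  have hA : aeval A q = Matrix.reindex P.σ P.σ
      (Matrix.blockDiagonal' fun i => aeval (companionMatrix (P.e i)) q) := by
    conv_lhs => rw [P.eq_reindex]
    rw [Matrix.aeval_reindex, Matrix.aeval_blockDiagonal']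
  have hA' (x y) : aeval A q (P.σ x) (P.σ y)
      = Matrix.blockDiagonal' (fun i => aeval (companionMatrix (P.e i)) q) x y := by
    rw [hA]; simp
  ext o j
  rw [Matrix.mul_apply, ← P.σ.sum_comp]
  refine Finset.sum_eq_zero fun y _ => ?_
  rw [Matrix.mul_apply, ← P.σ.sum_comp, Finset.sum_mul]
  refine Finset.sum_eq_zero fun x _ => ?_
  rw [hA']
  obtain ⟨l, a⟩ := x
  obtain ⟨l', b⟩ := y
  by_cases hl : l = l'
  · subst hl
    rw [Matrix.blockDiagonal'_apply_eq]
    rcases h l with h | h | h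
    · rw [h]; ring
    · rw [h]; ring
    · rw [aeval_companionMatrix_eq_zero (P.monic_e l) h]; simp
  · rw [Matrix.blockDiagonal'_apply_ne _ _ _ hl]; ring

end PrimaryBlocks

/-! ### Consequences of minimality for the blocks. -/

namespace LTISystem

variable {n nu : ℕ} {S : LTISystem n nu 1}

/-- If one of the three claims failed, the product of the other divisors would annihilate the Markov
parameters, and its degree is less than n. -/
theorem IsMinimal.block_nondegenerate (hS : S.IsMinimal) (P : PrimaryBlocks S.A) (i : Fin P.k) :
    (∃ a, S.C 0 (P.σ ⟨i, a⟩) ≠ 0) ∧ (∃ a j, S.B (P.σ ⟨i, a⟩) j ≠ 0) ∧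
      ¬ P.e i ∣ ∏ l ∈ Finset.univ.erase i, P.e l := by
  by_contra hcon
  have hle : n ≤ (∏ l ∈ Finset.univ.erase i, P.e l).natDegree := by
    refine hS.le_natDegree (monic_prod_of_monic _ _ fun l _ => P.monic_e l) fun r => ?_
    refine P.mul_aeval_mul_eq_zero _ _ _ fun l => ?_
    by_cases hl : l = i
    · subst hl
      by_contra! h
      obtain ⟨⟨o, a, ha⟩, hb, hd⟩ := h
      obtain rfl : o = 0 := Subsingleton.elim _ _
      exact hcon ⟨⟨a, ha⟩, hb, fun h => hd (h.mul_left _)⟩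
    · exact Or.inr (Or.inr ((Finset.dvd_prod_of_mem _ (by simp [hl])).mul_left _))
  rw [natDegree_prod_of_monic _ _ fun l _ => P.monic_e l] at hle
  have h1 := P.natDegree_prod
  rw [← Finset.add_sum_erase _ _ (Finset.mem_univ i)] at h1
  have := P.natDegree_e_pos i
  omega

theorem IsMinimal.injective_φ (hS : S.IsMinimal) (P : PrimaryBlocks S.A) :
    Function.Injective P.φ := by
  intro i j hij
  by_contra hne
  -- Of two powers of one prime, the smaller divides the larger.
  wlog hm : P.m i ≤ P.m j generalizing i j
  · exact this hij.symm (Ne.symm hne) (le_of_not_ge hm)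
  refine (hS.block_nondegenerate P i).2.2 (Dvd.dvd.trans ?_
    (Finset.dvd_prod_of_mem P.e (Finset.mem_erase.2 ⟨Ne.symm hne, Finset.mem_univ j⟩)))
  rw [PrimaryBlocks.e, PrimaryBlocks.e, hij]
  exact pow_dvd_pow _ hm

theorem IsMinimal.numIrreducibleFactors_eq (hS : S.IsMinimal) (P : PrimaryBlocks S.A) :
    S.A.numIrreducibleFactors = P.k := by
  have : {p : ℝ[X] | p.Monic ∧ Irreducible p ∧ p ∣ S.A.charpoly} = Set.range P.φ := by
    ext p
    rw [P.charpoly_eq]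
    constructor
    · rintro ⟨hp, hirr, hd⟩
      obtain ⟨i, -, hi⟩ := (hirr.prime.dvd_finsetProd_iff _).1 hd
      exact ⟨i, (eq_of_monic_of_associated hp (P.monic i)
        (hirr.associated_of_dvd (P.irreducible i) (hirr.prime.dvd_of_dvd_pow hi))).symm⟩
    · rintro ⟨i, rfl⟩
      exact ⟨P.monic i, P.irreducible i, (dvd_pow_self _ (P.pos i).ne').trans
        (Finset.dvd_prod_of_mem P.e (Finset.mem_univ i))⟩
  rw [Matrix.numIrreducibleFactors, this, Set.ncard_range_of_injective (hS.injective_φ P),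
    Nat.card_fin]

end LTISystem

/-! ### Strong components and edges of the condensed graph. -/

theorem companionMatrix_succ_ne_zero (l : ℝ[X]) {a b : Fin l.natDegree} (h : (b : ℕ) = a + 1) :
    companionMatrix l b a ≠ 0 := by
  have : (a : ℕ) + 1 ≠ l.natDegree := by omega
  simp [companionMatrix, this, h]

theorem companionMatrix_zero_last_ne_zero {l : ℝ[X]} (h0 : l.coeff 0 ≠ 0) {a b : Fin l.natDegree}
    (ha : (a : ℕ) + 1 = l.natDegree) (hb : (b : ℕ) = 0) : companionMatrix l b a ≠ 0 := by
  simp [companionMatrix, ha, hb, h0]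

/-- The graph of a companion matrix with nonzero constant coefficient is strongly connected. -/
theorem reflTransGen_companionMatrix {l : ℝ[X]} (h0 : l.coeff 0 ≠ 0) (a b : Fin l.natDegree) :
    Relation.ReflTransGen (companionMatrix l).associatedGraph.Adj a b := by
  have up : ∀ (d : ℕ) (a b : Fin l.natDegree), (b : ℕ) = a + d →
      Relation.ReflTransGen (companionMatrix l).associatedGraph.Adj a b := by
    intro d
    induction d with
    | zero => intro a b h; rw [Fin.ext h]
    | succ d ih =>
      intro a b h
      exact (ih a ⟨a + d, by omega⟩ rfl).tail (companionMatrix_succ_ne_zero l (by simp; omega))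
  have hpos : 0 < l.natDegree := a.pos
  have h1 := up (l.natDegree - 1 - a) a ⟨l.natDegree - 1, by omega⟩ (by simp; omega)
  have h2 := up b ⟨0, hpos⟩ b (by simp)
  -- Climb the subdiagonal to the last index, return to 0 along the edge of weight minus the
  -- constant term, then climb to `b`.
  exact (h1.tail (companionMatrix_zero_last_ne_zero h0 (by simp; omega) rfl)).trans h2

namespace LTISystem

variable {n : ℕ} {S : LTISystem n 1 1} (P : PrimaryBlocks S.A)

/-- The state vertices of a block. -/
def blockVertices (i : Fin P.k) : Set (Vertex n 1 1) :=
  Set.range fun a => Sum.inl (Sum.inl (P.σ ⟨i, a⟩))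

theorem graph_adj_state {x y} : S.graph.Adj (Sum.inl (Sum.inl (P.σ x))) (Sum.inl (Sum.inl (P.σ y)))
    ↔ Matrix.blockDiagonal' (fun i => companionMatrix (P.e i)) y x ≠ 0 := by
  rw [← P.apply_eq]
  rfl

theorem blockVertices_reachable (h0 : ∀ i, (P.e i).coeff 0 ≠ 0) {i : Fin P.k} {v w}
    (hv : v ∈ blockVertices P i) (hw : w ∈ blockVertices P i) :
    Relation.ReflTransGen S.graph.Adj v w := by
  obtain ⟨a, rfl⟩ := hv
  obtain ⟨b, rfl⟩ := hw
  refine (reflTransGen_companionMatrix (h0 i) a b).lift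
    (fun a => Sum.inl (Sum.inl (P.σ ⟨i, a⟩))) fun c d hcd => ?_
  rw [Function.onFun, graph_adj_state, Matrix.blockDiagonal'_apply_eq]
  exact hcd

theorem eq_of_graph_adj {i j : Fin P.k} {v w} (hv : v ∈ blockVertices P i)
    (hw : w ∈ blockVertices P j) (h : S.graph.Adj v w) : i = j := by
  obtain ⟨a, rfl⟩ := hv
  obtain ⟨b, rfl⟩ := hw
  by_contra hij
  rw [graph_adj_state] at h
  exact h (Matrix.blockDiagonal'_apply_ne _ _ _ (Ne.symm hij))

theorem mem_or_output_of_reachable {i : Fin P.k} {v w} (hv : v ∈ blockVertices P i)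
    (h : Relation.ReflTransGen S.graph.Adj v w) :
    w ∈ blockVertices P i ∨ ∃ j, w = Sum.inr j := by
  induction h with
  | refl => exact Or.inl hv
  | @tail w z _ hwz ih =>
    rcases ih with ih | ⟨j, rfl⟩
    · rcases z with (z | z) | z
      · obtain ⟨⟨j, b⟩, rfl⟩ := P.σ.surjective z
        have hz : Sum.inl (Sum.inl (P.σ ⟨j, b⟩)) ∈ blockVertices P j := ⟨b, rfl⟩
        obtain rfl := eq_of_graph_adj P ih hz hwz
        exact Or.inl hz
      · obtain ⟨a, rfl⟩ := ih
        exact absurd rfl hwz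
      -- A path that leaves the block can only end in an output, which has no outgoing edges.
      · exact Or.inr ⟨z, rfl⟩
    · rcases z with (z | z) | z <;> exact absurd rfl hwz

theorem not_reachable_of_output {j : Fin 1} {v : Fin n}
    (h : Relation.ReflTransGen S.graph.Adj (Sum.inr j) (Sum.inl (Sum.inl v))) : False := by
  rcases h.cases_head with h | ⟨z, hz, -⟩
  · simp at h
  · rcases z with (z | z) | z <;> exact absurd rfl hz

theorem blockVertices_eq_class (h0 : ∀ i, (P.e i).coeff 0 ≠ 0) {i : Fin P.k} {v}
    (hv : v ∈ blockVertices P i) :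
    blockVertices P i = {b | Relation.ReflTransGen S.graph.Adj v b ∧
      Relation.ReflTransGen S.graph.Adj b v} := by
  ext w
  constructor
  · exact fun hw => ⟨blockVertices_reachable P h0 hv hw, blockVertices_reachable P h0 hw hv⟩
  · rintro ⟨h1, h2⟩
    rcases mem_or_output_of_reachable P hv h1 with h | ⟨j, rfl⟩
    · exact h
    · obtain ⟨a, rfl⟩ := hv
      exact (not_reachable_of_output h2).elim

theorem exists_mem_blockVertices (i : Fin P.k) : ∃ v, v ∈ blockVertices P i :=
  ⟨_, ⟨⟨0, P.natDegree_e_pos i⟩, rfl⟩⟩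

theorem eq_of_mem_blockVertices {i j : Fin P.k} {v} (hi : v ∈ blockVertices P i)
    (hj : v ∈ blockVertices P j) : i = j := by
  obtain ⟨a, rfl⟩ := hi
  obtain ⟨b, hb⟩ := hj
  have := P.σ.injective (Sum.inl_injective (Sum.inl_injective hb))
  exact (congrArg Sigma.fst this).symm

theorem blockVertices_mem_stateComponents (h0 : ∀ i, (P.e i).coeff 0 ≠ 0) (i : Fin P.k) :
    blockVertices P i ∈ S.stateComponents := by
  obtain ⟨v, hv⟩ := exists_mem_blockVertices P i
  exact ⟨⟨v, blockVertices_eq_class P h0 hv⟩, by rintro _ ⟨a, rfl⟩; exact ⟨_, rfl⟩⟩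

/-- The state components are the blocks of the state matrix. -/
noncomputable def blockEquivComponents (h0 : ∀ i, (P.e i).coeff 0 ≠ 0) :
    Fin P.k ≃ S.stateComponents :=
  Equiv.ofBijective (fun i => ⟨blockVertices P i, blockVertices_mem_stateComponents P h0 i⟩) <| by
    constructor
    · intro i j hij
      obtain ⟨v, hv⟩ := exists_mem_blockVertices P i
      have h : blockVertices P i = blockVertices P j := congrArg Subtype.val hij
      exact eq_of_mem_blockVertices P hv (h ▸ hv)
    · rintro ⟨c, ⟨v, rfl⟩, hc⟩
      obtain ⟨z, rfl⟩ := hc v ⟨.refl, .refl⟩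
      obtain ⟨⟨i, a⟩, rfl⟩ := P.σ.surjective z
      exact ⟨i, Subtype.ext (blockVertices_eq_class P h0 ⟨a, rfl⟩)⟩

theorem condensedAdj_component_component (h0 : ∀ i, (P.e i).coeff 0 ≠ 0)
    (c c' : S.stateComponents) :
    S.condensedGraph.Adj (.component c) (.component c') ↔ c = c' := by
  obtain ⟨i, rfl⟩ := (blockEquivComponents P h0).surjective c
  obtain ⟨j, rfl⟩ := (blockEquivComponents P h0).surjective c'
  rw [(blockEquivComponents P h0).injective.eq_iff]
  constructor
  · rintro ⟨v, hv, w, hw, h⟩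
    exact eq_of_graph_adj P hv hw h
  · rintro rfl
    have hpos := P.natDegree_e_pos i
    -- The edge from the last index to 0 serves in every degree; in degree one it is a loop at a
    -- vertex.
    refine ⟨_, ⟨⟨(P.e i).natDegree - 1, Nat.sub_lt hpos one_pos⟩, rfl⟩, _, ⟨⟨0, hpos⟩, rfl⟩, ?_⟩
    rw [graph_adj_state, Matrix.blockDiagonal'_apply_eq]
    exact companionMatrix_zero_last_ne_zero (h0 i) (Nat.sub_add_cancel hpos) rfl

theorem IsMinimal.condensedAdj_input_component (hS : S.IsMinimal)
    (h0 : ∀ i, (P.e i).coeff 0 ≠ 0) (u : Fin 1) (c : S.stateComponents) :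
    S.condensedGraph.Adj (.input u) (.component c) := by
  obtain ⟨i, rfl⟩ := (blockEquivComponents P h0).surjective c
  obtain ⟨a, j, ha⟩ := (hS.block_nondegenerate P i).2.1
  obtain rfl : j = u := Subsingleton.elim _ _
  exact ⟨_, ⟨a, rfl⟩, ha⟩

theorem IsMinimal.condensedAdj_component_output (hS : S.IsMinimal)
    (h0 : ∀ i, (P.e i).coeff 0 ≠ 0) (c : S.stateComponents) (y : Fin 1) :
    S.condensedGraph.Adj (.component c) (.output y) := by
  obtain ⟨i, rfl⟩ := (blockEquivComponents P h0).surjective c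
  obtain ⟨a, ha⟩ := (hS.block_nondegenerate P i).1
  obtain rfl : 0 = y := Subsingleton.elim _ _
  exact ⟨_, ⟨a, rfl⟩, ha⟩

theorem condensedAdj_input_output (S : LTISystem n 1 1) (u y : Fin 1) :
    S.condensedGraph.Adj (.input u) (.output y) ↔ S.D ≠ 0 := by
  obtain rfl : u = 0 := Subsingleton.elim _ _
  obtain rfl : y = 0 := Subsingleton.elim _ _
  refine not_congr ⟨fun h => ?_, fun h => ?_⟩
  · ext i j
    obtain rfl : i = 0 := Subsingleton.elim _ _
    obtain rfl : j = 0 := Subsingleton.elim _ _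
    exact h
  · change S.D 0 0 = 0
    rw [h]; rfl

/-! ### Isomorphisms of condensed graphs. -/

/-- The map of condensed vertices induced by a map of state components. -/
def CondensedVertex.map {n₁ n₂ : ℕ} {S₁ : LTISystem n₁ 1 1} {S₂ : LTISystem n₂ 1 1}
    (f : S₁.stateComponents → S₂.stateComponents) : S₁.CondensedVertex → S₂.CondensedVertex
  | .input u => .input u
  | .component c => .component (f c)
  | .output y => .output y

theorem CondensedVertex.map_bijective {n₁ n₂ : ℕ} {S₁ : LTISystem n₁ 1 1} {S₂ : LTISystem n₂ 1 1}
    (f : S₁.stateComponents ≃ S₂.stateComponents) :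
    Function.Bijective (CondensedVertex.map (S₁ := S₁) (S₂ := S₂) f) := by
  constructor
  · rintro (u | c | y) (u' | c' | y') h <;> simp_all [CondensedVertex.map]
  · rintro (u | c | y)
    · exact ⟨.input u, rfl⟩
    · exact ⟨.component (f.symm c), by simp [CondensedVertex.map]⟩
    · exact ⟨.output y, rfl⟩

/-- Type restriction, applied to images and to preimages, makes the isomorphism restrict to a
bijection of components. -/
theorem IsCGIsomorphism.nonempty_equiv {n₁ n₂ : ℕ} {S₁ : LTISystem n₁ 1 1}
    {S₂ : LTISystem n₂ 1 1} {φ : S₁.CondensedVertex → S₂.CondensedVertex}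
    (h : IsCGIsomorphism S₁ S₂ φ) : Nonempty (S₁.stateComponents ≃ S₂.stateComponents) := by
  have hex : ∀ c, ∃ c', φ (.component c) = .component c' := by
    intro c
    have := h.typeRestricted (.component c)
    rcases hc : φ (.component c) with u | c' | y
    · simp [hc, SameType] at this
    · exact ⟨c', rfl⟩
    · simp [hc, SameType] at this
  choose f hf using hex
  refine ⟨Equiv.ofBijective f ⟨fun c d hcd => ?_, fun c' => ?_⟩⟩
  · have := h.bijective.1 ((hf c).trans ((congrArg _ hcd).trans (hf d).symm))
    exact CondensedVertex.component.inj this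
  · obtain ⟨v, hv⟩ := h.bijective.2 (.component c')
    have ht := h.typeRestricted v
    rcases v with u | c | y
    · simp [hv, SameType] at ht
    · exact ⟨c, CondensedVertex.component.inj ((hf c).symm.trans hv)⟩
    · simp [hv, SameType] at ht

theorem IsCGIsomorphism.D_ne_zero_iff {n₁ n₂ : ℕ} {S₁ : LTISystem n₁ 1 1}
    {S₂ : LTISystem n₂ 1 1} {φ : S₁.CondensedVertex → S₂.CondensedVertex}
    (h : IsCGIsomorphism S₁ S₂ φ) : S₁.D ≠ 0 ↔ S₂.D ≠ 0 := by
  rw [← condensedAdj_input_output S₁ 0 0, h.adj_iff]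
  have hu := h.typeRestricted (.input 0)
  have hy := h.typeRestricted (.output 0)
  rcases hu' : φ (.input 0) with u | c | y <;> simp [hu', SameType] at hu
  rcases hy' : φ (.output 0) with u' | c | y <;> simp [hy', SameType] at hy
  exact condensedAdj_input_output S₂ _ _

end LTISystem

theorem mainTheorem7 {n₁ n₂ : ℕ} (S₁ : LTISystem n₁ 1 1) (S₂ : LTISystem n₂ 1 1)
    (hmin₁ : S₁.IsMinimal) (hmin₂ : S₂.IsMinimal)
    (hnf₁ : S₁.A.IsSecondNaturalNormalForm) (hnf₂ : S₂.A.IsSecondNaturalNormalForm)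
    (h0₁ : ¬ Module.End.HasEigenvalue (Matrix.toLin' S₁.A) 0)
    (h0₂ : ¬ Module.End.HasEigenvalue (Matrix.toLin' S₂.A) 0) :
    S₁.CGIsomorphic S₂ ↔
      (S₁.A.numIrreducibleFactors = S₂.A.numIrreducibleFactors ∧
        ((S₁.D = 0 ∧ S₂.D = 0) ∨ (S₁.D ≠ 0 ∧ S₂.D ≠ 0))) := by
  obtain ⟨P₁⟩ := hnf₁.nonempty_primaryBlocks
  obtain ⟨P₂⟩ := hnf₂.nonempty_primaryBlocks
  have c₁ := P₁.coeff_zero_ne h0₁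
  have c₂ := P₂.coeff_zero_ne h0₂
  rw [hmin₁.numIrreducibleFactors_eq P₁, hmin₂.numIrreducibleFactors_eq P₂]
  constructor
  · rintro ⟨φ, hφ⟩
    obtain ⟨f⟩ := hφ.nonempty_equiv
    have hk := Fintype.card_congr ((LTISystem.blockEquivComponents P₁ c₁).trans
      (f.trans (LTISystem.blockEquivComponents P₂ c₂).symm))
    rw [Fintype.card_fin, Fintype.card_fin] at hk
    have := hφ.D_ne_zero_iff
    exact ⟨hk, by tauto⟩
  · rintro ⟨hk, hD⟩
    let f := (LTISystem.blockEquivComponents P₁ c₁).symm.trans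
      ((finCongr hk).trans (LTISystem.blockEquivComponents P₂ c₂))
    refine ⟨LTISystem.CondensedVertex.map f, ?_, LTISystem.CondensedVertex.map_bijective f, ?_⟩
    · rintro (u | c | y) <;> exact trivial
    -- Pairs that end in an input or start in an output have no edge on either side, by definition.
    · rintro (u | c | y) (u' | c' | y')
      · exact Iff.rfl
      · exact iff_of_true (hmin₁.condensedAdj_input_component P₁ c₁ u c')
          (hmin₂.condensedAdj_input_component P₂ c₂ u (f c'))
      · have h : S₁.D ≠ 0 ↔ S₂.D ≠ 0 := by tauto
        exact (S₁.condensedAdj_input_output u y').trans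
          (h.trans (S₂.condensedAdj_input_output u y').symm)
      · exact Iff.rfl
      · exact (LTISystem.condensedAdj_component_component P₁ c₁ c c').trans
          (f.injective.eq_iff.symm.trans
            (LTISystem.condensedAdj_component_component P₂ c₂ (f c) (f c')).symm)
      · exact iff_of_true (hmin₁.condensedAdj_component_output P₁ c₁ c y')
          (hmin₂.condensedAdj_component_output P₂ c₂ (f c) y')
      · exact Iff.rfl
      · exact Iff.rfl
      · exact Iff.rfl
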